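/- Let $d\ge 1$ and let $S^{d-1}\subset\mathbb{R}^d$ be the unit sphere. Let $(Q_k)_{k\ge 0}$ be the Gegenbauer polynomials on $S^{d-1}$: $Q_0(x)=1$, $Q_1(x)=dx$, $Q_2(x)=\frac{d+2}{2}(dx^2-1)$ and $$\frac{k+1}{d+2k}\,Q_{k+1}(x)=x\,Q_k(x)-\frac{d+k-3}{d+2k-4}\,Q_{k-1}(x)\qquad(k\ge 2).$$ For a finite non-empty set $X\subset S^{d-1}$ put $b_k=\frac1{|X|}\sum_{x,y\in X}Q_k(\langle x,y\rangle)$ for $k\ge 0$, let $A(X)=\{\langle x,y\rangle : x,y\in X,\ x\ne y\}$, and call $s=|A(X)|$ the degree of $X$. For integers $w\ge 0$ and $t\ge 1$, say that $X$ has the spherical dual zero interval $\{w+1,\dots,w+t\}$ if $b_w\neq 0$ and $b_{w+1}=\cdots=b_{w+t}=0$. Write $A(X)=\{\alpha_1,\dots,\alpha_s\}$ with $\alpha_1,\dots,\alpha_s$ distinct, $\alpha_0=1$, $R_i=\{(x,y)\in X\times X : \langle x,y\rangle=\alpha_i\}$ for $0\le i\le s$, and $R^X=\{R_0,\dots,R_s\}$.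 Let $X\subset S^{d-1}$ be a finite non-empty set having a spherical dual zero interval $\{w+1,\dots,w+t\}$ and degree $s$. If $2s-1\le t$, then $(X,R^X)$ is an $s$-class $Q$-polynomial scheme; that is: (1) $(X,R^X)$ is a symmetric association scheme with $s$ classes: $R_0$ is the diagonal, the $R_i$ are non-empty, symmetric and partition $X\times X$, and for all $i,j,k$ the number of $z\in X$ with $(x,z)\in R_i$ and $(z,y)\in R_j$ is the same for all $(x,y)\in R_k$; (2) the primitive idempotents of its Bose--Mesner algebra (the linear span of the adjacency matrices $A_0,\dots,A_s$ of $R_0,\dots,R_s$) can be ordered as $E_0=\frac1{|X|}J,E_1,\dots,E_s$, where $J$ is the all-ones matrix, so that for each $0\le i\le s$ there is a real polynomial $v_i^*$ of degree exactly $i$ such that $|X|E_i$ is obtained by applying $v_i^*$ to every entry of $|X|E_1$ (for $s=0$ this second condition is empty). -/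

import Mathlib

open Polynomial

namespace SphericalScheme

/-- The Gegenbauer polynomials `Q_k` on the unit sphere of `ℝ^d`: `Q_0 = 1`, `Q_1 = d x` and
`(k+1)/(d+2k) Q_{k+1} = x Q_k - (d+k-3)/(d+2k-4) Q_{k-1}` for `k ≥ 1`.
For `k = 1` the last coefficient is `(d-2)/(d-2)`, read as `1` (also for `d = 2`), so
`Q_2 = (d+2)/2 * (d x^2 - 1)` is listed separately; for `k ≥ 2`, `d ≥ 1` no denominator vanishes. -/
noncomputable def gegenbauer (d : ℕ) : ℕ → ℝ[X]
  | 0 => 1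
  | 1 => C (d : ℝ) * X
  | 2 => C (((d : ℝ) + 2) / 2) * (C (d : ℝ) * X ^ 2 - 1)
  | (k + 3) =>
      C (((d : ℝ) + 2 * ((k : ℝ) + 2)) / ((k : ℝ) + 3)) *
        (X * gegenbauer d (k + 2) -
          C (((d : ℝ) + ((k : ℝ) + 2) - 3) / ((d : ℝ) + 2 * ((k : ℝ) + 2) - 4)) *
            gegenbauer d (k + 1))

/-- The unit sphere `S^{d-1}` in `ℝ^d`. -/
abbrev UnitSphere (d : ℕ) : Type := Metric.sphere (0 : EuclideanSpace ℝ (Fin d)) 1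

/-- The Euclidean inner product of two points of the sphere. -/
noncomputable def ip {d : ℕ} (x y : UnitSphere d) : ℝ :=
  inner ℝ (x : EuclideanSpace ℝ (Fin d)) (y : EuclideanSpace ℝ (Fin d))

/-- `b_k = |X|⁻¹ ∑_{x,y ∈ X} Q_k(⟨x,y⟩)`. -/
noncomputable def b {d : ℕ} (X : Finset (UnitSphere d)) (k : ℕ) : ℝ :=
  (1 / (X.card : ℝ)) * ∑ x ∈ X, ∑ y ∈ X, (gegenbauer d k).eval (ip x y)

/-- `X` has the spherical dual zero interval `{w+1, …, w+t}`, where `t ≥ 1`. -/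
def HasDualZeroInterval {d : ℕ} (X : Finset (UnitSphere d)) (w t : ℕ) : Prop :=
  1 ≤ t ∧ b X w ≠ 0 ∧ ∀ k ∈ Finset.Icc (w + 1) (w + t), b X k = 0

/-- The degree set `A(X)` of inner products of distinct points of `X`. -/
def degreeSet {d : ℕ} (X : Finset (UnitSphere d)) : Set ℝ :=
  {a | ∃ x ∈ X, ∃ y ∈ X, x ≠ y ∧ ip x y = a}

/-- The degree of `X` (the degree set is finite). -/
noncomputable def sphDegree {d : ℕ} (X : Finset (UnitSphere d)) : ℕ := (degreeSet X).ncard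

/-- Given an enumeration `α_1, …, α_s` of `A(X)`, and with `α_0 = 1`, the relations
`R_i = {(x,y) ∈ X × X | ⟨x,y⟩ = α_i}`, `0 ≤ i ≤ s`. -/
def sphereRel {d s : ℕ} (X : Finset (UnitSphere d)) (α : Fin s ≃ degreeSet X) :
    Fin (s + 1) → X → X → Prop :=
  fun i x y => ip x.1 y.1 = (Fin.cons 1 (fun j => (α j : ℝ)) : Fin (s + 1) → ℝ) i

/-- `(V, {R_0, …, R_s})` is a (symmetric) association scheme with `s` classes. -/
structure IsAssociationScheme {V : Type*} {s : ℕ} (R : Fin (s + 1) → V → V → Prop) : Prop where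
  diag : ∀ x y, R 0 x y ↔ x = y
  partition : ∀ x y, ∃! i, R i x y
  nonempty : ∀ i, ∃ x y, R i x y
  symm : ∀ i x y, R i x y → R i y x
  intersection : ∀ i j k, ∃ p : ℕ, ∀ x y, R k x y → {z | R i x z ∧ R j z y}.ncard = p

open Classical in
/-- The adjacency matrix `A_i` of the relation `R_i`. -/
noncomputable def adjMatrix {V : Type*} {s : ℕ} (R : Fin (s + 1) → V → V → Prop)
    (i : Fin (s + 1)) : Matrix V V ℝ :=
  Matrix.of fun x y => if R i x y then 1 else 0

/-- The Bose--Mesner algebra of the scheme, as the linear span of the adjacency matrices. -/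
noncomputable def boseMesner {V : Type*} {s : ℕ} (R : Fin (s + 1) → V → V → Prop) :
    Submodule ℝ (Matrix V V ℝ) :=
  Submodule.span ℝ (Set.range (adjMatrix R))

open Classical in
/-- `E_0, …, E_s` is an ordering of the primitive idempotents of the Bose--Mesner algebra with
`E_0 = |V|⁻¹ J`: a basis of the algebra with `E_i E_j = δ_{ij} E_i` and `∑ E_i = I`. -/
structure IsIdempotentOrdering {V : Type*} [Fintype V] {s : ℕ} (R : Fin (s + 1) → V → V → Prop)
    (E : Fin (s + 1) → Matrix V V ℝ) : Prop where
  zero : E 0 = Matrix.of fun _ _ => 1 / (Fintype.card V : ℝ)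
  idem : CompleteOrthogonalIdempotents E
  linearIndependent : LinearIndependent ℝ E
  span_eq : Submodule.span ℝ (Set.range E) = boseMesner R

/-- `(V, R)` is an `s`-class `Q`-polynomial scheme: an association scheme whose primitive
idempotents can be ordered `E_0 = |V|⁻¹ J, E_1, …, E_s` so that for every `i` there is a polynomial
`v_i` of degree exactly `i` with `|V| E_i = v_i(|V| E_1)` for the entrywise product.
(For `s = 0` the only condition is on `E_0`, where `v_0` is a constant.) -/
def IsQPolynomialScheme {V : Type*} [Fintype V] {s : ℕ} (R : Fin (s + 1) → V → V → Prop) : Prop :=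
  IsAssociationScheme R ∧
    ∃ E : Fin (s + 1) → Matrix V V ℝ, IsIdempotentOrdering R E ∧
      ∀ i : Fin (s + 1), ∃ v : ℝ[X], v.degree = ((i : ℕ) : WithBot ℕ) ∧
        ∀ x y, (Fintype.card V : ℝ) * E i x y = v.eval ((Fintype.card V : ℝ) * E 1 x y)

end SphericalScheme

/-! The zonal polynomial Z_k(x, ·), the homogenization of Q_k(⟨x, ·⟩), reproduces harmonic
polynomials of degree k up to a positive constant, for the Fischer inner product (`fischer_zonal`).
If b_k = 0, then S = ∑_{z ∈ X} Z_k(z, ·) has Fischer norm zero, so S = 0, and every harmonic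
polynomial of degree k sums to zero over X.

On the sphere, a linear form times a harmonic polynomial of degree k splits into harmonic parts of
degrees k + 1 and k - 1. Multiplying Q_{w+s}(⟨x, ·⟩) by at most s - 1 linear forms therefore only
produces degrees in {w+1, …, w+2s-1}, which lies in the zero interval because 2s - 1 ≤ t. With G the
Gram matrix of X, T = Q_{w+s} and polynomials applied entrywise, this says (qT)(G) f(G) = 0 whenever
deg q + deg f < s (`sum_gegenbauer_mul_eq_zero`).

The rest is linear algebra on a symmetric kernel with s + 1 values. A trace argument shows that T
vanishes at none of them. A dimension count then finds, for each i ≤ s, a nonzero r_i of degree at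
most i agreeing on these values with a multiple qT, deg q ≤ s - i; so r_i(G) annihilates all f(G)
with deg f < i. These s + 1 matrices are pairwise orthogonal, hence a basis of the span of the A_i.
Rescaled so as to sum to I they become idempotents, which gives closure under multiplication and the
Q-polynomial property together. -/

namespace SphericalScheme

/-! ### Harmonic polynomials: Laplacian, directional derivatives, multiplication by linear forms. -/

section Harmonic

variable {d : ℕ}

/-- The linear form `z ↦ ⟨x, z⟩`. -/
noncomputable def linForm (x : Fin d → ℝ) : MvPolynomial (Fin d) ℝ :=
  ∑ i, MvPolynomial.C (x i) * MvPolynomial.X i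

/-- The squared norm `z ↦ |z|²`. -/
noncomputable def normSq : MvPolynomial (Fin d) ℝ := ∑ i, MvPolynomial.X i ^ 2

/-- The directional derivative along `x`. -/
noncomputable def dirDeriv (x : Fin d → ℝ) :
    Derivation ℝ (MvPolynomial (Fin d) ℝ) (MvPolynomial (Fin d) ℝ) :=
  ∑ i, x i • MvPolynomial.pderiv i

/-- The Laplace operator. -/
noncomputable def laplacian : MvPolynomial (Fin d) ℝ →ₗ[ℝ] MvPolynomial (Fin d) ℝ :=
  ∑ i, (MvPolynomial.pderiv i).toLinearMap ∘ₗ (MvPolynomial.pderiv i).toLinearMap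

lemma dirDeriv_apply (x : Fin d → ℝ) (p : MvPolynomial (Fin d) ℝ) :
    dirDeriv x p = ∑ i, MvPolynomial.C (x i) * MvPolynomial.pderiv i p := by
  have h := congrFun (map_sum (Derivation.coeFnAddMonoidHom (R := ℝ)
    (A := MvPolynomial (Fin d) ℝ) (M := MvPolynomial (Fin d) ℝ))
    (fun i => x i • MvPolynomial.pderiv i) Finset.univ) p
  refine h.trans ?_
  simp [Derivation.coeFnAddMonoidHom, MvPolynomial.smul_eq_C_mul]

lemma laplacian_apply (p : MvPolynomial (Fin d) ℝ) :
    laplacian p = ∑ i, MvPolynomial.pderiv i (MvPolynomial.pderiv i p) := by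
  simp [laplacian]

lemma pderiv_comm (i j : Fin d) (p : MvPolynomial (Fin d) ℝ) :
    MvPolynomial.pderiv i (MvPolynomial.pderiv j p) =
      MvPolynomial.pderiv j (MvPolynomial.pderiv i p) := by
  let D (i : Fin d) : Derivation ℝ (MvPolynomial (Fin d) ℝ) (MvPolynomial (Fin d) ℝ) :=
    MvPolynomial.pderiv i
  have h : ⁅D i, D j⁆ = 0 := by
    apply MvPolynomial.derivation_ext
    intro k
    rw [Derivation.commutator_apply]
    by_cases hik : k = i <;> by_cases hjk : k = j <;>
      simp [D, MvPolynomial.pderiv_X, Pi.single_apply, hik, hjk]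
    all_goals split_ifs <;> simp
  have := congrArg (fun D => D p) h
  simpa [D, Derivation.commutator_apply, sub_eq_zero] using this

lemma pderiv_linForm (x : Fin d → ℝ) (i : Fin d) :
    MvPolynomial.pderiv i (linForm x) = MvPolynomial.C (x i) := by
  simp [linForm, MvPolynomial.pderiv_X, Pi.single_apply]

lemma pderiv_normSq (i : Fin d) :
    MvPolynomial.pderiv i (normSq : MvPolynomial (Fin d) ℝ) = 2 * MvPolynomial.X i := by
  simp [normSq, MvPolynomial.pderiv_X, Pi.single_apply]

lemma dirDeriv_linForm (x y : Fin d → ℝ) :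
    dirDeriv x (linForm y) = MvPolynomial.C (∑ i, x i * y i) := by
  simp [dirDeriv_apply, pderiv_linForm]

lemma dirDeriv_normSq (x : Fin d → ℝ) : dirDeriv x normSq = 2 * linForm x := by
  rw [dirDeriv_apply, linForm, Finset.mul_sum]
  exact Finset.sum_congr rfl fun i _ => by rw [pderiv_normSq]; ring

lemma isHomogeneous_linForm (x : Fin d → ℝ) : (linForm x).IsHomogeneous 1 :=
  MvPolynomial.IsHomogeneous.sum _ _ _ fun i _ => by
    simpa using (MvPolynomial.isHomogeneous_C (Fin d) (x i)).mul (MvPolynomial.isHomogeneous_X ℝ i)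

lemma isHomogeneous_normSq : (normSq : MvPolynomial (Fin d) ℝ).IsHomogeneous 2 :=
  MvPolynomial.IsHomogeneous.sum _ _ _ fun i _ => by
    simpa using (MvPolynomial.isHomogeneous_X ℝ i).pow 2

lemma isHomogeneous_dirDeriv (x : Fin d → ℝ) {p : MvPolynomial (Fin d) ℝ} {k : ℕ}
    (hp : p.IsHomogeneous (k + 1)) : (dirDeriv x p).IsHomogeneous k := by
  rw [dirDeriv_apply]
  exact MvPolynomial.IsHomogeneous.sum _ _ _ fun i _ => by
    simpa using (MvPolynomial.isHomogeneous_C (Fin d) (x i)).mul (hp.pderiv (i := i))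

lemma laplacian_dirDeriv (x : Fin d → ℝ) (p : MvPolynomial (Fin d) ℝ) :
    laplacian (dirDeriv x p) = dirDeriv x (laplacian p) := by
  simp only [laplacian_apply, dirDeriv_apply, map_sum, MvPolynomial.pderiv_C_mul]
  rw [Finset.sum_comm]
  refine Finset.sum_congr rfl fun i _ => Finset.sum_congr rfl fun j _ => ?_
  rw [pderiv_comm i j p, pderiv_comm i j]

lemma laplacian_mul (p q : MvPolynomial (Fin d) ℝ) :
    laplacian (p * q) = laplacian p * q +
      2 * ∑ i, MvPolynomial.pderiv i p * MvPolynomial.pderiv i q + p * laplacian q := by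
  simp only [laplacian_apply, Finset.mul_sum, Finset.sum_mul, ← Finset.sum_add_distrib]
  refine Finset.sum_congr rfl fun i _ => ?_
  simp only [MvPolynomial.pderiv_mul, map_add]
  ring

lemma laplacian_linForm_mul (x : Fin d → ℝ) (p : MvPolynomial (Fin d) ℝ) :
    laplacian (linForm x * p) = 2 * dirDeriv x p + linForm x * laplacian p := by
  rw [laplacian_mul, dirDeriv_apply, laplacian_apply (linForm x)]
  simp [pderiv_linForm]

lemma laplacian_normSq_mul {p : MvPolynomial (Fin d) ℝ} {k : ℕ} (hp : p.IsHomogeneous k) :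
    laplacian (normSq * p) =
      MvPolynomial.C (2 * ((d : ℝ) + 2 * k)) * p + normSq * laplacian p := by
  have h1 : laplacian (normSq : MvPolynomial (Fin d) ℝ) = MvPolynomial.C (2 * (d : ℝ)) := by
    rw [laplacian_apply]
    simp only [pderiv_normSq]
    have : ∀ i : Fin d, MvPolynomial.pderiv i (2 * MvPolynomial.X i : MvPolynomial (Fin d) ℝ) =
        2 := fun i => by
      rw [two_mul, map_add, MvPolynomial.pderiv_X_self]; norm_num
    rw [Finset.sum_congr rfl fun i _ => this i]
    simp [mul_comm]
    exact Or.inl (map_ofNat _ 2).symm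
  have h2 : 2 * ∑ i, MvPolynomial.pderiv i (normSq : MvPolynomial (Fin d) ℝ) *
      MvPolynomial.pderiv i p = MvPolynomial.C (4 * (k : ℝ)) * p := by
    have := hp.sum_X_mul_pderiv
    simp only [pderiv_normSq, mul_assoc, ← Finset.mul_sum]
    rw [this, map_mul, map_natCast, map_ofNat, nsmul_eq_mul]
    ring
  rw [laplacian_mul, h1, h2]
  simp only [map_mul, map_add, map_ofNat]
  ring

/-- Harmonic homogeneous polynomials of degree `k`. -/
def IsHarmonic (k : ℕ) (p : MvPolynomial (Fin d) ℝ) : Prop :=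
  p.IsHomogeneous k ∧ laplacian p = 0

lemma IsHarmonic.dirDeriv {k : ℕ} {p : MvPolynomial (Fin d) ℝ} (hp : IsHarmonic (k + 1) p)
    (x : Fin d → ℝ) : IsHarmonic k (dirDeriv x p) :=
  ⟨isHomogeneous_dirDeriv x hp.1, by rw [laplacian_dirDeriv, hp.2, map_zero]⟩

/-- The harmonic part of `linForm x * p`, for `p` harmonic of degree `k + 1`. -/
lemma IsHarmonic.raise (hd : 1 ≤ d) {k : ℕ} {p : MvPolynomial (Fin d) ℝ}
    (hp : IsHarmonic (k + 1) p) (x : Fin d → ℝ) :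
    IsHarmonic (k + 2) (linForm x * p -
      MvPolynomial.C (1 / ((d : ℝ) + 2 * k)) * (normSq * SphericalScheme.dirDeriv x p)) := by
  have hd' : (d : ℝ) + 2 * k ≠ 0 := by positivity
  have hq := hp.dirDeriv x
  constructor
  · refine MvPolynomial.IsHomogeneous.sub ?_ ?_
    · have := (isHomogeneous_linForm x).mul hp.1
      rwa [show 1 + (k + 1) = k + 2 by ring] at this
    · have := (MvPolynomial.isHomogeneous_C (Fin d) (1 / ((d : ℝ) + 2 * k))).mul
        (isHomogeneous_normSq.mul hq.1)
      rwa [show 0 + (2 + k) = k + 2 by ring] at this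
  -- With D the derivative along x: Δ(⟨x,z⟩p) = 2 D p, while Δ(|z|² D p) = 2(d + 2k) D p since D p
  -- is harmonic of degree k; this fixes the constant.
  · rw [map_sub, laplacian_linForm_mul, hp.2, ← MvPolynomial.smul_eq_C_mul, map_smul,
      laplacian_normSq_mul hq.1, hq.2, MvPolynomial.smul_eq_C_mul, mul_zero, mul_zero, add_zero,
      add_zero, ← mul_assoc, ← map_mul, show 1 / ((d : ℝ) + 2 * k) * (2 * (d + 2 * k)) = 2 by
        field_simp]
    rw [map_ofNat, sub_self]

lemma eval_linForm (x y : Fin d → ℝ) : MvPolynomial.eval y (linForm x) = ∑ i, x i * y i := by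
  simp [linForm]

lemma eval_dirDeriv_self (x : Fin d → ℝ) {p : MvPolynomial (Fin d) ℝ} {k : ℕ}
    (hp : p.IsHomogeneous k) :
    MvPolynomial.eval x (dirDeriv x p) = k * MvPolynomial.eval x p := by
  have := congrArg (MvPolynomial.eval x) hp.sum_X_mul_pderiv
  simpa [dirDeriv_apply] using this

end Harmonic

/-! ### Fischer inner product and zonal harmonics. -/

section Zonal

variable {d : ℕ}

/-- The Fischer inner product `⟨p, q⟩ = ∑ m, m! p_m q_m`. -/
noncomputable def fischer :
    MvPolynomial (Fin d) ℝ →ₗ[ℝ] MvPolynomial (Fin d) ℝ →ₗ[ℝ] ℝ :=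
  ((MvPolynomial.basisMonomials (Fin d) ℝ).constr ℝ).toLinearMap ∘ₗ
    LinearMap.pi fun m => ((∏ i, (m i).factorial : ℕ) : ℝ) • MvPolynomial.lcoeff ℝ m

lemma fischer_monomial (p : MvPolynomial (Fin d) ℝ) (m : Fin d →₀ ℕ) (c : ℝ) :
    fischer p (MvPolynomial.monomial m c) =
      c * (((∏ i, (m i).factorial : ℕ) : ℝ) * p.coeff m) := by
  have h : MvPolynomial.monomial m c = c • MvPolynomial.basisMonomials (Fin d) ℝ m := by
    simp [MvPolynomial.smul_monomial]
  rw [h, map_smul, fischer, LinearMap.comp_apply, LinearEquiv.coe_coe, Module.Basis.constr_basis]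
  simp

lemma fischer_self_eq_zero {p : MvPolynomial (Fin d) ℝ} (hp : fischer p p = 0) : p = 0 := by
  have h : fischer p p =
      ∑ m ∈ p.support, ((∏ i, (m i).factorial : ℕ) : ℝ) * p.coeff m ^ 2 := by
    refine (congrArg (fischer p) p.as_sum).trans ?_
    rw [map_sum]
    exact Finset.sum_congr rfl fun m _ => by rw [fischer_monomial]; ring
  rw [h, Finset.sum_eq_zero_iff_of_nonneg fun m _ => by positivity] at hp
  by_contra hne
  obtain ⟨m, hm⟩ := MvPolynomial.support_nonempty.2 hne
  have h1 := hp m hm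
  have h2 : ((∏ i, (m i).factorial : ℕ) : ℝ) ≠ 0 :=
    Nat.cast_ne_zero.2 (Finset.prod_ne_zero_iff.2 fun i _ => Nat.factorial_ne_zero _)
  exact MvPolynomial.mem_support_iff.1 hm 
    (pow_eq_zero_iff two_ne_zero |>.1 ((mul_eq_zero.1 h1).resolve_left h2))

/-- The factorial weights are chosen for this adjointness: raising an exponent multiplies the weight
by the factor that differentiation produces. -/
lemma fischer_X_mul (i : Fin d) (p q : MvPolynomial (Fin d) ℝ) :
    fischer p (MvPolynomial.X i * q) = fischer (MvPolynomial.pderiv i p) q := by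
  induction q using MvPolynomial.induction_on' with
  | add a b ha hb => rw [mul_add, map_add, map_add, ha, hb]
  | monomial m c =>
    have hf : ∏ j, ((m + Finsupp.single i 1 : Fin d →₀ ℕ) j).factorial =
        (m i + 1) * ∏ j, (m j).factorial := by
      have : ∀ j, ((m + Finsupp.single i 1 : Fin d →₀ ℕ) j).factorial =
          (if j = i then m i + 1 else 1) * (m j).factorial := fun j => by
        by_cases h : j = i
        · subst h; simp [Nat.factorial_succ]
        · simp [h]
      rw [Finset.prod_congr rfl fun j _ => this j, Finset.prod_mul_distrib]
      simp
    rw [MvPolynomial.X, MvPolynomial.monomial_mul, one_mul, add_comm, fischer_monomial,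
      fischer_monomial, MvPolynomial.coeff_pderiv, hf]
    push_cast
    ring

lemma fischer_linForm_mul (x : Fin d → ℝ) (p q : MvPolynomial (Fin d) ℝ) :
    fischer p (linForm x * q) = fischer (dirDeriv x p) q := by
  rw [linForm, dirDeriv_apply, Finset.sum_mul, map_sum, map_sum, LinearMap.sum_apply]
  refine Finset.sum_congr rfl fun i _ => ?_
  rw [mul_assoc, ← MvPolynomial.smul_eq_C_mul, ← MvPolynomial.smul_eq_C_mul, map_smul, map_smul,
    LinearMap.smul_apply, fischer_X_mul]

lemma fischer_normSq_mul (p q : MvPolynomial (Fin d) ℝ) :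
    fischer p (normSq * q) = fischer (laplacian p) q := by
  rw [normSq, laplacian_apply, Finset.sum_mul, map_sum, map_sum, LinearMap.sum_apply]
  refine Finset.sum_congr rfl fun i _ => ?_
  rw [pow_two, mul_assoc, fischer_X_mul, fischer_X_mul]

/-- The coefficients of the three-term recurrence, with the first one equal to `1`. -/
noncomputable def recCoeff (d : ℕ) : ℕ → ℝ
  | 0 => 1
  | (k + 1) => ((d : ℝ) + k - 1) / ((d : ℝ) + 2 * k)

/-- The zonal harmonic `z ↦ |z|^k Q_k(⟨x, z⟩ / |z|)` as a polynomial. -/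
noncomputable def zonal (x : Fin d → ℝ) : ℕ → MvPolynomial (Fin d) ℝ
  | 0 => 1
  | 1 => MvPolynomial.C (d : ℝ) * linForm x
  | (k + 2) => MvPolynomial.C (((d : ℝ) + 2 * (k + 1)) / (k + 2)) *
      (linForm x * zonal x (k + 1) - MvPolynomial.C (recCoeff d k) * (normSq * zonal x k))

lemma zonal_add_two (x : Fin d → ℝ) (k : ℕ) : zonal x (k + 2) =
    MvPolynomial.C (((d : ℝ) + 2 * (k + 1)) / (k + 2)) *
      (linForm x * zonal x (k + 1) - MvPolynomial.C (recCoeff d k) * (normSq * zonal x k)) := rfl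

lemma eval_zonal (x y : Fin d → ℝ) (hy : ∑ i, y i ^ 2 = 1) (k : ℕ) :
    MvPolynomial.eval y (zonal x k) = (gegenbauer d k).eval (∑ i, x i * y i) := by
  have hN : MvPolynomial.eval y normSq = 1 := by simpa [normSq] using hy
  induction k using gegenbauer.induct with
  | case1 => simp [zonal, gegenbauer]
  | case2 => simp [zonal, gegenbauer, eval_linForm]
  | case3 =>
    simp only [zonal, gegenbauer, recCoeff, map_mul, map_sub, map_one, MvPolynomial.eval_C,
      eval_linForm, hN, Polynomial.eval_mul, Polynomial.eval_sub, Polynomial.eval_C,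
      Polynomial.eval_pow, Polynomial.eval_X, Polynomial.eval_one]
    push_cast
    ring
  | case4 k ih1 ih2 =>
    rw [zonal, gegenbauer]
    simp only [recCoeff, map_mul, map_sub, MvPolynomial.eval_C,
      eval_linForm, hN, Polynomial.eval_mul, Polynomial.eval_sub, Polynomial.eval_C,
      Polynomial.eval_X, ih1, ih2]
    push_cast
    ring_nf

/-- Links the three-term recurrence to `IsHarmonic.raise`, and through Euler's identity gives the
values Q_k(1). Proved by differentiating the recurrence. -/
lemma dirDeriv_zonal (hd : 1 ≤ d) {x : Fin d → ℝ} (hx : ∑ i, x i ^ 2 = 1) (k : ℕ) :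
    dirDeriv x (zonal x (k + 1)) =
      MvPolynomial.C (((d : ℝ) + 2 * k) * recCoeff d k) * zonal x k := by
  have hd' : (1 : ℝ) ≤ d := by exact_mod_cast hd
  have hx1 : dirDeriv x (linForm x) = 1 := by
    rw [dirDeriv_linForm, Finset.sum_congr rfl fun i _ => (pow_two (x i)).symm, hx, map_one]
  have hC (c : ℝ) (p : MvPolynomial (Fin d) ℝ) :
      dirDeriv x (MvPolynomial.C c * p) = MvPolynomial.C c * dirDeriv x p := by
    rw [← MvPolynomial.smul_eq_C_mul, Derivation.map_smul, MvPolynomial.smul_eq_C_mul]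
  have hL (p q : MvPolynomial (Fin d) ℝ) :
      dirDeriv x (p * q) = p * dirDeriv x q + dirDeriv x p * q := by
    rw [Derivation.leibniz, smul_eq_mul, smul_eq_mul, mul_comm q]
  induction k using Nat.twoStepInduction with
  | zero => simp [zonal, hx1, recCoeff]
  | one =>
    change dirDeriv x (zonal x (0 + 2)) = MvPolynomial.C _ * zonal x (0 + 1)
    rw [zonal_add_two, hC, map_sub, hC, hL, hL, hx1, zonal, zonal, hC, hx1, dirDeriv_normSq,
      Derivation.map_one_eq_zero]
    have : (((d : ℝ) + 2 * ((0 : ℕ) + 1)) / ((0 : ℕ) + 2)) * (2 * d - 2) =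
      ((d : ℝ) + 2 * (1 : ℕ)) * recCoeff d 1 * d := by
      simp only [recCoeff]; push_cast; field_simp; ring
    have h := congrArg (MvPolynomial.C (σ := Fin d)) this
    simp only [map_mul, map_sub, map_ofNat, recCoeff, map_one] at h ⊢
    linear_combination linForm x * h
  | more k ih1 ih2 =>
    have hrec : MvPolynomial.C (recCoeff d k) * (normSq * zonal x k) =
        linForm x * zonal x (k + 1) -
          MvPolynomial.C (((k : ℝ) + 2) / ((d : ℝ) + 2 * (k + 1))) * zonal x (k + 2) := by
      rw [zonal, ← mul_assoc (MvPolynomial.C _) (MvPolynomial.C _), ← map_mul, show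
        ((k : ℝ) + 2) / ((d : ℝ) + 2 * (k + 1)) * (((d : ℝ) + 2 * (k + 1)) / (k + 2)) = 1 by
          field_simp, map_one]
      ring
    rw [zonal_add_two, hC, map_sub, hC, hL, hL, hx1, dirDeriv_normSq, ih1, ih2]
    -- Once `hrec` eliminates |z|² Z_k, `h1` matches the coefficients of Z_{k+2}, and `h2` cancels
    -- the terms in ⟨x,z⟩ Z_{k+1}.
    have h1 : (((d : ℝ) + 2 * ((k + 1 : ℕ) + 1)) / ((k + 1 : ℕ) + 2)) *
        (1 + recCoeff d (k + 1) * ((d : ℝ) + 2 * k) * (((k : ℝ) + 2) / ((d : ℝ) + 2 * (k + 1)))) =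
        ((d : ℝ) + 2 * (k + 2 : ℕ)) * recCoeff d (k + 2) := by
      simp only [recCoeff]; push_cast; field_simp; ring
    have h2 : ((d : ℝ) + 2 * (k + 1 : ℕ)) * recCoeff d (k + 1) - 2 * recCoeff d (k + 1) -
        recCoeff d (k + 1) * ((d : ℝ) + 2 * k) = 0 := by
      push_cast; ring
    have h1' := congrArg (MvPolynomial.C (σ := Fin d)) h1
    have h2' := congrArg (MvPolynomial.C (σ := Fin d)) h2
    rw [← h1']
    simp only [map_mul, map_sub, map_add, map_ofNat, map_one, map_zero] at h2' hrec ⊢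
    generalize MvPolynomial.C (((d : ℝ) + 2 * ((k + 1 : ℕ) + 1)) / ((k + 1 : ℕ) + 2)) = A at *
    linear_combination A * linForm x * zonal x (k + 1) * h2' -
      A * MvPolynomial.C (recCoeff d (k + 1)) *
        (MvPolynomial.C (d : ℝ) + 2 * MvPolynomial.C (k : ℝ)) * hrec

/-- By `dirDeriv_zonal`, the recurrence is, up to a scalar, the harmonic raising operator applied to
the previous zonal polynomial. -/
lemma isHarmonic_zonal (hd : 1 ≤ d) {x : Fin d → ℝ} (hx : ∑ i, x i ^ 2 = 1) (k : ℕ) :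
    IsHarmonic k (zonal x k) := by
  have hC {n : ℕ} (c : ℝ) {p : MvPolynomial (Fin d) ℝ} (hp : IsHarmonic n p) :
      IsHarmonic n (MvPolynomial.C c * p) := by
    refine ⟨?_, by rw [← MvPolynomial.smul_eq_C_mul, map_smul, hp.2, smul_zero]⟩
    simpa using (MvPolynomial.isHomogeneous_C (Fin d) c).mul hp.1
  induction k using Nat.twoStepInduction with
  | zero => exact ⟨MvPolynomial.isHomogeneous_one _ _, by simp [zonal, laplacian_apply]⟩
  | one =>
    refine hC _ ⟨isHomogeneous_linForm x, ?_⟩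
    simp [laplacian_apply, pderiv_linForm]
  | more k _ ih =>
    have h := ih.raise hd x
    have hd' : (d : ℝ) + 2 * k ≠ 0 := by
      have : (1 : ℝ) ≤ d := by exact_mod_cast hd
      positivity
    rw [dirDeriv_zonal hd hx, mul_left_comm normSq, ← mul_assoc (MvPolynomial.C _), ← map_mul,
      show 1 / ((d : ℝ) + 2 * k) * ((d + 2 * k) * recCoeff d k) = recCoeff d k by
        field_simp] at h
    exact hC _ h

/-- The constants in the reproducing property of the zonal harmonics. -/
noncomputable def reproConst (d k : ℕ) : ℝ := ∏ j ∈ Finset.range k, ((d : ℝ) + 2 * j)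

lemma reproConst_pos (hd : 1 ≤ d) (k : ℕ) : 0 < reproConst d k :=
  Finset.prod_pos fun j _ => by
    have : (1 : ℝ) ≤ d := by exact_mod_cast hd
    positivity

/-- In the recurrence the |z|² term pairs with p through Δp = 0, and the linear form moves to p as
the derivative along x. Induction applies to that derivative, and Euler's identity evaluates it at
x. -/
lemma fischer_zonal {k : ℕ} {p : MvPolynomial (Fin d) ℝ} (hp : IsHarmonic k p) (x : Fin d → ℝ) :
    fischer p (zonal x k) = reproConst d k * MvPolynomial.eval x p := by
  induction k generalizing p with
  | zero =>
    obtain ⟨c, rfl⟩ : ∃ c, p = MvPolynomial.C c :=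
      ⟨_, MvPolynomial.totalDegree_eq_zero_iff_eq_C.1
        ((MvPolynomial.totalDegree_zero_iff_isHomogeneous _).2 hp.1)⟩
    have h := fischer_monomial (MvPolynomial.C c : MvPolynomial (Fin d) ℝ) 0 1
    rw [show MvPolynomial.monomial 0 (1 : ℝ) = (1 : MvPolynomial (Fin d) ℝ) from rfl] at h
    rw [zonal, h]
    simp [reproConst]
  | succ k ih =>
    have h := ih (hp.dirDeriv x)
    rw [eval_dirDeriv_self x hp.1] at h
    have hr : reproConst d (k + 1) = reproConst d k * ((d : ℝ) + 2 * k) :=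
      Finset.prod_range_succ _ _
    rcases k with _ | k
    · rw [zonal, ← MvPolynomial.smul_eq_C_mul, map_smul, ← mul_one (linForm x),
        fischer_linForm_mul, show (1 : MvPolynomial (Fin d) ℝ) = zonal x 0 from rfl, h, hr]
      simp; ring
    · rw [zonal, ← MvPolynomial.smul_eq_C_mul, map_smul, map_sub, ← MvPolynomial.smul_eq_C_mul,
        map_smul, fischer_normSq_mul, hp.2, fischer_linForm_mul, h, hr]
      simp only [map_zero, LinearMap.zero_apply, smul_eq_mul]
      push_cast
      field_simp
      ring

end Zonal

/-! ### Sums over X: from vanishing b_k to the orthogonality relation. -/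

section Sphere

variable {d : ℕ}

lemma ip_eq_sum (x y : UnitSphere d) : ip x y = ∑ i, x.1 i * y.1 i := by
  simp only [ip, PiLp.inner_apply]
  exact Finset.sum_congr rfl fun i _ => by simp [mul_comm]

lemma ip_comm (x y : UnitSphere d) : ip x y = ip y x := real_inner_comm _ _

lemma ip_self (x : UnitSphere d) : ip x x = 1 := by
  have h : ‖(x : EuclideanSpace ℝ (Fin d))‖ = 1 := by simp
  simp [ip, h]

lemma ip_eq_one_iff (x y : UnitSphere d) : ip x y = 1 ↔ x = y := by
  rw [ip, inner_eq_one_iff_of_norm_eq_one (by simp) (by simp), Subtype.ext_iff]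

lemma sum_sq_eq_one (x : UnitSphere d) : ∑ i, x.1 i ^ 2 = 1 := by
  have h := ip_self x
  rw [ip_eq_sum] at h
  exact (Finset.sum_congr rfl fun i _ => pow_two _).trans h

lemma eval_zonal_sphere (x y : UnitSphere d) (k : ℕ) :
    MvPolynomial.eval y.1.ofLp (zonal x.1.ofLp k) = (gegenbauer d k).eval (ip x y) := by
  rw [eval_zonal _ _ (sum_sq_eq_one y), ip_eq_sum]

lemma eval_normSq_sphere (x : UnitSphere d) : MvPolynomial.eval x.1.ofLp normSq = 1 := by
  simpa [normSq] using sum_sq_eq_one x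

lemma eval_linForm_sphere (x y : UnitSphere d) :
    MvPolynomial.eval y.1.ofLp (linForm x.1.ofLp) = ip x y := by
  rw [eval_linForm, ip_eq_sum]

/-- If `b_k = 0`, then all harmonic polynomials of degree `k` sum to zero over `X`. -/
lemma sum_eval_harmonic_eq_zero (hd : 1 ≤ d) {X : Finset (UnitSphere d)} (hX : X.Nonempty) {k : ℕ}
    (hb : b X k = 0) {p : MvPolynomial (Fin d) ℝ} (hp : IsHarmonic k p) :
    ∑ z ∈ X, MvPolynomial.eval z.1.ofLp p = 0 := by
  have hγ := (reproConst_pos hd k).ne'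
  set S : MvPolynomial (Fin d) ℝ := ∑ z ∈ X, zonal z.1.ofLp k with hS
  have hz (z : UnitSphere d) := isHarmonic_zonal hd (sum_sq_eq_one z) k
  have hfS {q : MvPolynomial (Fin d) ℝ} (hq : IsHarmonic k q) :
      fischer q S = reproConst d k * ∑ z ∈ X, MvPolynomial.eval z.1.ofLp q := by
    rw [hS, map_sum, Finset.mul_sum]
    exact Finset.sum_congr rfl fun z _ => fischer_zonal hq _
  have hSh : IsHarmonic k S :=
    ⟨MvPolynomial.IsHomogeneous.sum _ _ _ fun z _ => (hz z).1, by
      rw [hS, map_sum]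
      exact Finset.sum_eq_zero fun z _ => (hz z).2⟩
  have hsum : ∑ z ∈ X, MvPolynomial.eval z.1.ofLp S = 0 := by
    have hc : (1 / (X.card : ℝ)) ≠ 0 := by
      have := hX.card_pos
      positivity
    rw [b] at hb
    rw [← (mul_eq_zero.1 hb).resolve_left hc, Finset.sum_comm]
    refine Finset.sum_congr rfl fun z _ => ?_
    rw [hS, map_sum]
    exact Finset.sum_congr rfl fun y _ => eval_zonal_sphere y z k
  -- The reproducing property applied to S itself: its Fischer norm is a multiple of ∑_z S(z) = |X|
  -- b_k = 0.
  have hS0 : S = 0 := fischer_self_eq_zero (by rw [hfS hSh, hsum, mul_zero])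
  have := hfS hp
  rw [hS0, map_zero] at this
  exact (mul_eq_zero.1 this.symm).resolve_left hγ

/-- Products of harmonic polynomials with few linear forms sum to zero over a set with a
dual zero interval. -/
lemma sum_eval_harmonic_mul_linForms_eq_zero (hd : 1 ≤ d) {X : Finset (UnitSphere d)}
    (hX : X.Nonempty) {w t : ℕ} (hb : ∀ k ∈ Finset.Icc (w + 1) (w + t), b X k = 0)
    (L : List (Fin d → ℝ)) {k : ℕ} {p : MvPolynomial (Fin d) ℝ} (hp : IsHarmonic k p)
    (h1 : w + 1 + L.length ≤ k) (h2 : k + L.length ≤ w + t) :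
    ∑ z ∈ X, MvPolynomial.eval z.1.ofLp (p * (L.map linForm).prod) = 0 := by
  induction L generalizing k p with
  | nil =>
    simp only [List.length_nil, add_zero] at h1 h2
    simpa using sum_eval_harmonic_eq_zero hd hX (hb k (Finset.mem_Icc.2 ⟨h1, h2⟩)) hp
  | cons x L ih =>
    rw [List.length_cons] at h1 h2
    obtain ⟨m, rfl⟩ : ∃ m, k = m + 1 := ⟨k - 1, by omega⟩
    -- Absorbing one linear form moves the degree by ±1; the window of degrees reachable with the
    -- remaining forms stays inside the old one.
    have e1 := ih (hp.raise hd x) (by omega) (by omega)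
    have e2 := ih (hp.dirDeriv x) (by omega) (by omega)
    have hz : ∀ z ∈ X, MvPolynomial.eval z.1.ofLp (p * ((x :: L).map linForm).prod) =
        MvPolynomial.eval z.1.ofLp ((linForm x * p - MvPolynomial.C (1 / ((d : ℝ) + 2 * m)) *
          (normSq * dirDeriv x p)) * (L.map linForm).prod) + 1 / ((d : ℝ) + 2 * m) *
        MvPolynomial.eval z.1.ofLp (dirDeriv x p * (L.map linForm).prod) := fun z _ => by
      simp only [List.map_cons, List.prod_cons, map_mul, map_sub, eval_normSq_sphere,
        MvPolynomial.eval_C]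
      ring
    rw [Finset.sum_congr rfl hz, Finset.sum_add_distrib, e1, ← Finset.mul_sum, e2]
    simp

/-- The orthogonality relation provided by a dual zero interval of length at least `2s - 1`. -/
lemma sum_gegenbauer_mul_eq_zero (hd : 1 ≤ d) {X : Finset (UnitSphere d)}
    (hX : X.Nonempty) {w t s : ℕ} (hb : ∀ k ∈ Finset.Icc (w + 1) (w + t), b X k = 0)
    (hst : 2 * (s : ℤ) - 1 ≤ (t : ℤ)) {q f : ℝ[X]} (hqf : q.natDegree + f.natDegree < s)
    (x y : UnitSphere d) :
    ∑ z ∈ X, (q * gegenbauer d (w + s)).eval (ip x z) * f.eval (ip z y) = 0 := by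
  have hmon : ∀ i ≤ q.natDegree, ∀ j ≤ f.natDegree,
      ∑ z ∈ X, (gegenbauer d (w + s)).eval (ip x z) * (ip x z ^ i * ip z y ^ j) = 0 := by
    intro i hi j hj
    -- Here i + j ≤ s - 1, so the degrees reached from w + s stay between w + 1 and w + 2s - 1 ≤ w +
    -- t.
    have h := sum_eval_harmonic_mul_linForms_eq_zero hd hX hb
      (List.replicate i x.1.ofLp ++ List.replicate j y.1.ofLp)
      (isHarmonic_zonal hd (sum_sq_eq_one x) (w + s))
      (by simp; omega) (by simp; omega)
    rw [← h]
    refine Finset.sum_congr rfl fun z _ => ?_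
    rw [map_mul, eval_zonal_sphere]
    simp [eval_linForm_sphere, ip_comm z y]
  have hexp : ∀ z ∈ X, (q * gegenbauer d (w + s)).eval (ip x z) * f.eval (ip z y) =
      ∑ i ∈ Finset.range (q.natDegree + 1), ∑ j ∈ Finset.range (f.natDegree + 1),
        q.coeff i * f.coeff j *
          ((gegenbauer d (w + s)).eval (ip x z) * (ip x z ^ i * ip z y ^ j)) := fun z _ => by
    rw [Polynomial.eval_mul, Polynomial.eval_eq_sum_range (p := q),
      Polynomial.eval_eq_sum_range (p := f), mul_right_comm, Finset.sum_mul_sum, Finset.sum_mul]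
    refine Finset.sum_congr rfl fun i _ => ?_
    rw [Finset.sum_mul]
    exact Finset.sum_congr rfl fun j _ => by ring
  rw [Finset.sum_congr rfl hexp, Finset.sum_comm]
  refine Finset.sum_eq_zero fun i hi => ?_
  rw [Finset.sum_comm]
  refine Finset.sum_eq_zero fun j hj => ?_
  rw [← Finset.mul_sum, hmon i (Nat.lt_succ_iff.1 (Finset.mem_range.1 hi)) j
    (Nat.lt_succ_iff.1 (Finset.mem_range.1 hj)), mul_zero]

/-- Euler's identity and `dirDeriv_zonal` express (k+1) Q_{k+1}(1) as a multiple of Q_k(1). For d =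
1 the factor vanishes at k = 1. -/
lemma eval_one_gegenbauer_pos (hd : 2 ≤ d) (x : UnitSphere d) (k : ℕ) :
    0 < (gegenbauer d k).eval 1 := by
  have hd' : (2 : ℝ) ≤ d := by exact_mod_cast hd
  have hx := sum_sq_eq_one x
  induction k with
  | zero => simp [gegenbauer]
  | succ k ih =>
    have h := eval_dirDeriv_self x.1.ofLp (isHarmonic_zonal (by omega) hx (k + 1)).1
    rw [dirDeriv_zonal (by omega) hx, map_mul, MvPolynomial.eval_C, eval_zonal_sphere,
      eval_zonal_sphere, ip_self] at h
    have hc : 0 < recCoeff d k := by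
      rcases k with _ | k
      · simp [recCoeff]
      · rw [recCoeff]
        have : (0 : ℝ) ≤ k := k.cast_nonneg
        exact div_pos (by linarith) (by linarith)
    have h2 : 0 < ((d : ℝ) + 2 * k) * recCoeff d k * (gegenbauer d k).eval 1 := by positivity
    rw [h] at h2
    exact pos_of_mul_pos_right h2 (Nat.cast_nonneg _)

end Sphere

/-! ### Polynomials applied entrywise to a symmetric kernel with s + 1 values. -/

section EntrywisePolynomial

variable {V : Type*}

/-- The matrix obtained by applying `p` to every entry of the kernel `g`. -/
noncomputable def entrywise (g : V → V → ℝ) : ℝ[X] →ₗ[ℝ] Matrix V V ℝ where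
  toFun p := Matrix.of fun x y => p.eval (g x y)
  map_add' p q := by ext; simp
  map_smul' c p := by ext; simp

@[simp] lemma entrywise_apply (g : V → V → ℝ) (p : ℝ[X]) (x y : V) :
    entrywise g p x y = p.eval (g x y) := rfl

variable {g : V → V → ℝ} {s : ℕ} {a : Fin (s + 1) → ℝ}

lemma transpose_entrywise (hsymm : ∀ x y, g x y = g y x) (p : ℝ[X]) :
    (entrywise g p).transpose = entrywise g p := by
  ext x y
  rw [Matrix.transpose_apply, entrywise_apply, entrywise_apply, hsymm]

lemma entrywise_eq_zero_iff (hval : ∀ x y, ∃ i, g x y = a i) (hne : ∀ i, ∃ x y, g x y = a i)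
    (p : ℝ[X]) : entrywise g p = 0 ↔ ∀ i, p.eval (a i) = 0 := by
  constructor
  · intro h i
    obtain ⟨x, y, hxy⟩ := hne i
    have := congrFun (congrFun h x) y
    rwa [entrywise_apply, hxy] at this
  · intro h
    ext x y
    obtain ⟨i, hi⟩ := hval x y
    rw [entrywise_apply, hi, h i]
    rfl

lemma eq_zero_of_natDegree_le_of_eval_eq_zero (ha : Function.Injective a) {p : ℝ[X]}
    (hp : p.natDegree ≤ s) (h : ∀ i, p.eval (a i) = 0) : p = 0 :=
  Polynomial.eq_zero_of_natDegree_lt_card_of_eval_eq_zero p ha h (by simpa using hp)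

variable [Fintype V]

lemma entrywise_mul_comm_of_eq_zero (hsymm : ∀ x y, g x y = g y x) {p q : ℝ[X]}
    (h : entrywise g p * entrywise g q = 0) : entrywise g q * entrywise g p = 0 := by
  have := congrArg Matrix.transpose h
  rwa [Matrix.transpose_mul, transpose_entrywise hsymm, transpose_entrywise hsymm,
    Matrix.transpose_zero] at this

lemma trace_entrywise_mul (hsymm : ∀ x y, g x y = g y x) (p q : ℝ[X]) :
    (entrywise g p * entrywise g q).trace = ∑ x, ∑ y, p.eval (g x y) * q.eval (g x y) := by
  simp only [Matrix.trace, Matrix.diag, Matrix.mul_apply, entrywise_apply]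
  exact Finset.sum_congr rfl fun x _ => Finset.sum_congr rfl fun y _ => by rw [hsymm y x]

/-- The trace of the square of a real symmetric matrix is the sum of its squared entries. -/
lemma entrywise_eq_zero_of_mul_self (hsymm : ∀ x y, g x y = g y x) {p : ℝ[X]}
    (h : entrywise g p * entrywise g p = 0) : entrywise g p = 0 := by
  have h1 := trace_entrywise_mul hsymm p p
  rw [h, Matrix.trace_zero, eq_comm,
    Finset.sum_eq_zero_iff_of_nonneg fun x _ => Finset.sum_nonneg fun y _ => mul_self_nonneg _]
    at h1
  ext x y
  have h2 := (Finset.sum_eq_zero_iff_of_nonneg fun y _ => mul_self_nonneg _).1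
    (h1 x (Finset.mem_univ x)) y (Finset.mem_univ y)
  simpa using h2

/-- If `entrywise g T` is orthogonal to all polynomials of degree `< s` in the kernel, then it has
no zero entry. -/
lemma eval_ne_zero_of_mul_eq_zero (hsymm : ∀ x y, g x y = g y x) (ha : Function.Injective a)
    (hval : ∀ x y, ∃ i, g x y = a i) (hne : ∀ i, ∃ x y, g x y = a i) {T : ℝ[X]}
    (hT : entrywise g T ≠ 0)
    (hmul : ∀ f : ℝ[X], f.natDegree < s → entrywise g T * entrywise g f = 0) (i : Fin (s + 1)) :
    T.eval (a i) ≠ 0 := by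
  intro hi
  refine hT ((entrywise_eq_zero_iff hval hne T).2 fun j => ?_)
  by_cases hij : j = i
  · rw [hij, hi]
  -- This f, of degree s - 1, vanishes at every value except a_i and a_j. Since T(a_i) = 0, the
  -- trace of T(g) f(g) sees only a_j, which forces T(a_j) = 0.
  set f : ℝ[X] := ∏ k ∈ (Finset.univ.erase i).erase j, (X - C (a k)) with hf
  have hcard : ((Finset.univ.erase i).erase j).card = s - 1 := by
    rw [Finset.card_erase_of_mem (by simpa using hij), Finset.card_erase_of_mem (by simp)]
    simp
  have hs : 0 < s := by
    by_contra h0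
    obtain rfl : s = 0 := by omega
    exact hij (Fin.ext (by omega))
  have hdeg : f.natDegree < s := by
    rw [hf, Polynomial.natDegree_prod_of_monic _ _ fun k _ => Polynomial.monic_X_sub_C _]
    simp only [Polynomial.natDegree_X_sub_C, Finset.sum_const, hcard]
    simp only [smul_eq_mul, mul_one]
    omega
  have hfj : f.eval (a j) ≠ 0 := by
    rw [hf, Polynomial.eval_prod, Finset.prod_ne_zero_iff]
    intro k hk
    simpa [sub_eq_zero] using fun h => (Finset.mem_erase.1 hk).1 (ha h).symm
  have hfk : ∀ k, k ≠ i → k ≠ j → f.eval (a k) = 0 := fun k hki hkj => by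
    rw [hf, Polynomial.eval_prod]
    exact Finset.prod_eq_zero (i := k) (by simp [hki, hkj]) (by simp)
  have htr := trace_entrywise_mul hsymm T f
  rw [hmul f hdeg, Matrix.trace_zero] at htr
  have hterm : ∀ x y, T.eval (g x y) * f.eval (g x y) =
      (if g x y = a j then 1 else 0) * (T.eval (a j) * f.eval (a j)) := fun x y => by
    obtain ⟨k, hk⟩ := hval x y
    rw [hk]
    by_cases hkj : k = j
    · simp [hkj]
    · rw [if_neg fun h => hkj (ha h), zero_mul]
      by_cases hki : k = i
      · rw [hki, hi, zero_mul]
      · rw [hfk k hki hkj, mul_zero]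
  simp only [hterm, ← Finset.sum_mul] at htr
  have hpos : (∑ x, ∑ y, if g x y = a j then (1 : ℝ) else 0) ≠ 0 := by
    obtain ⟨x, y, hxy⟩ := hne j
    refine ne_of_gt (Finset.sum_pos' (fun _ _ => Finset.sum_nonneg fun _ _ => by positivity)
      ⟨x, Finset.mem_univ x, Finset.sum_pos' (fun _ _ => by positivity)
        ⟨y, Finset.mem_univ y, by simp [hxy]⟩⟩)
  exact (mul_eq_zero.1 ((mul_eq_zero.1 htr.symm).resolve_left hpos)).resolve_right hfj

/-- For each `i ≤ s` some non-zero polynomial of degree at most `i` in the kernel annihilates all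
polynomials of degree `< i` in the kernel. -/
lemma exists_annihilating_polynomial (hsymm : ∀ x y, g x y = g y x) (ha : Function.Injective a)
    (hval : ∀ x y, ∃ i, g x y = a i) (hne : ∀ i, ∃ x y, g x y = a i) {T : ℝ[X]}
    (hT : entrywise g T ≠ 0)
    (hmul : ∀ q f : ℝ[X], q.natDegree + f.natDegree < s →
      entrywise g (q * T) * entrywise g f = 0) (i : ℕ) (hi : i ≤ s) :
    ∃ r : ℝ[X], r.natDegree ≤ i ∧ entrywise g r ≠ 0 ∧
      ∀ f : ℝ[X], f.natDegree < i → entrywise g r * entrywise g f = 0 := by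
  have hT' := eval_ne_zero_of_mul_eq_zero hsymm ha hval hne hT fun f hf => by
    simpa using hmul 1 f (by simpa using hf)
  let ev : ℝ[X] →ₗ[ℝ] (Fin (s + 1) → ℝ) := LinearMap.pi fun j => Polynomial.leval (a j)
  let Φ : Polynomial.degreeLT ℝ (s - i + 1) × Polynomial.degreeLT ℝ (i + 1) →ₗ[ℝ]
      (Fin (s + 1) → ℝ) :=
    (ev ∘ₗ LinearMap.mulRight ℝ T ∘ₗ Submodule.subtype _).coprod (-(ev ∘ₗ Submodule.subtype _))
  have (n : ℕ) : Module.Finite ℝ (Polynomial.degreeLT ℝ n) :=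
    Module.Finite.equiv (Polynomial.degreeLTEquiv ℝ n).symm
  have hfr (n : ℕ) : Module.finrank ℝ (Polynomial.degreeLT ℝ n) = n := by
    rw [(Polynomial.degreeLTEquiv ℝ n).finrank_eq]; simp
  -- The pairs (q, r) form a space of dimension (s-i+1) + (i+1) = s + 2, while qT = r is imposed at
  -- only s + 1 values.
  have hker : LinearMap.ker Φ ≠ ⊥ := by
    apply LinearMap.ker_ne_bot_of_finrank_lt
    rw [Module.finrank_prod, hfr, hfr]
    simp
    omega
  obtain ⟨⟨⟨q, hq⟩, ⟨r, hr⟩⟩, hqr, hne0⟩ := (Submodule.ne_bot_iff _).1 hker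
  have hdeg {n : ℕ} {p : ℝ[X]} (hp : p ∈ Polynomial.degreeLT ℝ (n + 1)) : p.natDegree ≤ n := by
    by_cases h0 : p = 0
    · simp [h0]
    · exact Nat.lt_succ_iff.1
        ((Polynomial.natDegree_lt_iff_degree_lt h0).2 (Polynomial.mem_degreeLT.1 hp))
  have heq : ∀ j, (q * T).eval (a j) = r.eval (a j) := fun j => by
    have := congrFun (LinearMap.mem_ker.1 hqr) j
    simpa [Φ, ev, ← sub_eq_add_neg, sub_eq_zero] using this
  have hM : entrywise g (q * T) = entrywise g r := by
    rw [← sub_eq_zero, ← map_sub, entrywise_eq_zero_iff hval hne]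
    intro j
    rw [Polynomial.eval_sub, heq, sub_self]
  refine ⟨r, hdeg hr, fun h0 => hne0 ?_, fun f hf => ?_⟩
  · have h1 := (entrywise_eq_zero_iff hval hne r).1 h0
    have hr0 := eq_zero_of_natDegree_le_of_eval_eq_zero ha ((hdeg hr).trans hi) h1
    have hq0 := eq_zero_of_natDegree_le_of_eval_eq_zero ha ((hdeg hq).trans (Nat.sub_le _ _))
      fun j => by
        have := heq j
        rw [h1 j, Polynomial.eval_mul] at this
        exact (mul_eq_zero.1 this).resolve_right (hT' j)
    subst hr0 hq0
    rfl
  · rw [← hM]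
    refine hmul q f ?_
    have := hdeg hq
    omega

end EntrywisePolynomial

/-! ### From orthogonal polynomials to idempotents and the scheme. -/

section AbstractScheme

variable {V : Type*} {g : V → V → ℝ} {s : ℕ} {a : Fin (s + 1) → ℝ}

lemma entrywise_mem_boseMesner (ha : Function.Injective a)
    (hval : ∀ x y, ∃ i, g x y = a i) (p : ℝ[X]) :
    entrywise g p ∈ boseMesner fun i x y => g x y = a i := by
  have h : entrywise g p = ∑ i, p.eval (a i) • adjMatrix (fun i x y => g x y = a i) i := by
    ext x y
    obtain ⟨k, hk⟩ := hval x y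
    simp [Matrix.sum_apply, adjMatrix, hk, ha.eq_iff]
  rw [h]
  exact Submodule.sum_mem _ fun i _ => Submodule.smul_mem _ _ (Submodule.subset_span ⟨i, rfl⟩)

variable [Fintype V]

open Classical in
/-- An orthogonal system of polynomials in the kernel yields the primitive idempotents. -/
lemma exists_idempotent_polynomials (hsymm : ∀ x y, g x y = g y x) (ha : Function.Injective a)
    (hval : ∀ x y, ∃ i, g x y = a i) (hdiag : ∀ x y, g x y = a 0 ↔ x = y) {r : ℕ → ℝ[X]}
    (hdeg : ∀ i ≤ s, (r i).natDegree ≤ i) (hr : ∀ i ≤ s, entrywise g (r i) ≠ 0)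
    (hmul : ∀ i ≤ s, ∀ f : ℝ[X], f.natDegree < i → entrywise g (r i) * entrywise g f = 0) :
    ∃ e : Fin (s + 1) → ℝ[X], (∀ i, (e i).degree = ((i : ℕ) : WithBot ℕ)) ∧
      (∀ i, entrywise g (e i) ≠ 0) ∧
      CompleteOrthogonalIdempotents (fun i => entrywise g (e i)) ∧
      LinearIndependent ℝ (fun i => entrywise g (e i)) ∧
      Submodule.span ℝ (Set.range fun i => entrywise g (e i)) =
        boseMesner fun i x y => g x y = a i := by
  let R : Fin (s + 1) → Matrix V V ℝ := fun i => entrywise g (r i)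
  have hi (i : Fin (s + 1)) : (i : ℕ) ≤ s := Nat.lt_succ_iff.1 i.2
  have hR0 : ∀ i, R i ≠ 0 := fun i => hr i (hi i)
  have hort : ∀ i j, i ≠ j → R i * R j = 0 := by
    have key : ∀ i j : Fin (s + 1), j < i → R i * R j = 0 := fun i j hij =>
      hmul i (hi i) _ ((hdeg j (hi j)).trans_lt hij)
    intro i j hij
    rcases lt_or_gt_of_ne hij with h | h
    · exact entrywise_mul_comm_of_eq_zero hsymm (key j i h)
    · exact key i j h
  have hsq : ∀ i, R i * R i ≠ 0 := fun i h => hR0 i (entrywise_eq_zero_of_mul_self hsymm h)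
  have hsum (c : Fin (s + 1) → ℝ) (j : Fin (s + 1)) :
      (∑ i, c i • R i) * R j = c j • (R j * R j) := by
    rw [Finset.sum_mul, Finset.sum_eq_single j (fun i _ hij => by
      rw [Matrix.smul_mul, hort i j hij, smul_zero]) (by simp), Matrix.smul_mul]
  have hli : LinearIndependent ℝ R := by
    rw [Fintype.linearIndependent_iff]
    intro c hc j
    have := hsum c j
    rw [hc, zero_mul, eq_comm, smul_eq_zero] at this
    exact this.resolve_right (hsq j)
  have hspan : Submodule.span ℝ (Set.range R) = boseMesner fun i x y => g x y = a i := by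
    refine Submodule.eq_of_le_of_finrank_le ?_ ?_
    · rw [Submodule.span_le]
      rintro _ ⟨i, rfl⟩
      exact entrywise_mem_boseMesner ha hval _
    · rw [finrank_span_eq_card hli]
      exact finrank_range_le_card _
  have hone : (1 : Matrix V V ℝ) ∈ Submodule.span ℝ (Set.range R) := by
    rw [hspan]
    refine Submodule.subset_span ⟨0, ?_⟩
    ext x y
    simp [adjMatrix, hdiag, Matrix.one_apply]
  -- Multiplying I = ∑ μ_i R_i by R_j gives μ_j R_j² = R_j, so the μ_j R_j are idempotents.
  obtain ⟨μ, hμ⟩ := (Submodule.mem_span_range_iff_exists_fun ℝ).1 hone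
  have hμR : ∀ j, μ j • (R j * R j) = R j := fun j => by rw [← hsum, hμ, one_mul]
  have hμ0 : ∀ j, μ j ≠ 0 := fun j h => hR0 j (by rw [← hμR j, h, zero_smul])
  have hE : (fun i => entrywise g (μ i • r (i : ℕ))) = fun i => μ i • R i := by
    funext i
    rw [map_smul]
  have hliμ : LinearIndependent ℝ fun i => μ i • R i :=
    hli.units_smul fun i => Units.mk0 (μ i) (hμ0 i)
  refine ⟨fun i => μ i • r i, fun i => ?_, fun i => ?_, ?_, ?_, ?_⟩
  · have hri : r i ≠ 0 := fun h => hr i (hi i) (by rw [h, map_zero])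
    rw [Polynomial.degree_smul_of_smul_regular _ (IsSMulRegular.of_ne_zero (hμ0 i)),
      Polynomial.degree_eq_natDegree hri, Nat.cast_inj]
    -- If the degree were below i, R_i would annihilate itself.
    refine le_antisymm (hdeg i (hi i)) (not_lt.1 fun h => hsq i (hmul i (hi i) _ h))
  · rw [map_smul]
    exact smul_ne_zero (hμ0 i) (hR0 i)
  · rw [hE]
    refine ⟨⟨fun i => ?_, fun i j hij => ?_⟩, hμ⟩
    · rw [IsIdempotentElem, Matrix.smul_mul, Matrix.mul_smul, hμR]
    · change μ i • R i * μ j • R j = 0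
      rw [Matrix.smul_mul, Matrix.mul_smul, hort i j hij, smul_zero, smul_zero]
  · rw [hE]
    exact hliμ
  · rw [hE, ← hspan]
    refine Submodule.eq_of_le_of_finrank_eq ?_ ?_
    · rw [Submodule.span_le]
      rintro _ ⟨i, rfl⟩
      exact Submodule.smul_mem _ _ (Submodule.subset_span ⟨i, rfl⟩)
    · rw [finrank_span_eq_card hliμ, finrank_span_eq_card hli]

/-- The relations of a kernel form an association scheme if the Bose--Mesner space is closed under
multiplication. -/
lemma isAssociationScheme_of_mul_mem (hsymm : ∀ x y, g x y = g y x) (ha : Function.Injective a)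
    (hval : ∀ x y, ∃ i, g x y = a i) (hne : ∀ i, ∃ x y, g x y = a i)
    (hdiag : ∀ x y, g x y = a 0 ↔ x = y)
    (hmul : ∀ A ∈ boseMesner (fun i x y => g x y = a i),
      ∀ B ∈ boseMesner (fun i x y => g x y = a i), A * B ∈ boseMesner fun i x y => g x y = a i) :
    IsAssociationScheme fun i x y => g x y = a i where
  diag := hdiag
  partition x y := by
    obtain ⟨i, h⟩ := hval x y
    exact ⟨i, h, fun j hj => ha (hj.symm.trans h)⟩
  nonempty := hne
  symm i x y h := (hsymm y x).trans h
  intersection i j k := by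
    classical
    obtain ⟨c, hc⟩ := (Submodule.mem_span_range_iff_exists_fun ℝ).1
      (hmul _ (Submodule.subset_span ⟨i, rfl⟩) _ (Submodule.subset_span ⟨j, rfl⟩))
    -- The (x, y) entry of A_i A_j counts the z; in the expansion ∑ c_l A_l that entry depends only
    -- on the relation of (x, y).
    have hcount (x y : V) (h : g x y = a k) :
        (({z | g x z = a i ∧ g z y = a j}.ncard : ℕ) : ℝ) = c k := by
      have h1 := congrFun (congrFun hc x) y
      simp only [Matrix.sum_apply, Matrix.smul_apply, adjMatrix, Matrix.of_apply, h, ha.eq_iff,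
        Matrix.mul_apply] at h1
      rw [Set.ncard_eq_toFinset_card']
      simpa [← ite_and, Finset.filter_and, Finset.inter_comm] using h1.symm
    obtain ⟨x₀, y₀, h₀⟩ := hne k
    refine ⟨{z | g x₀ z = a i ∧ g z y₀ = a j}.ncard, fun x y h => ?_⟩
    exact_mod_cast (hcount x y h).trans (hcount x₀ y₀ h₀).symm

/-- A kernel with `s + 1` values, together with a non-zero polynomial `T` in it whose multiples
annihilate low degree polynomials in it, gives a `Q`-polynomial scheme. -/
theorem isQPolynomialScheme_of_annihilator (hsymm : ∀ x y, g x y = g y x)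
    (ha : Function.Injective a) (hval : ∀ x y, ∃ i, g x y = a i)
    (hne : ∀ i, ∃ x y, g x y = a i) (hdiag : ∀ x y, g x y = a 0 ↔ x = y) {T : ℝ[X]}
    (hT : entrywise g T ≠ 0)
    (hmul : ∀ q f : ℝ[X], q.natDegree + f.natDegree < s →
      entrywise g (q * T) * entrywise g f = 0) :
    IsQPolynomialScheme fun i x y => g x y = a i := by
  classical
  have hex := exists_annihilating_polynomial hsymm ha hval hne hT hmul
  choose! r hr using hex
  obtain ⟨e, hdeg, hE0, hE, hli, hspan⟩ := exists_idempotent_polynomials hsymm ha hval hdiag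
    (fun i h => (hr i h).1) (fun i h => (hr i h).2.1) fun i h => (hr i h).2.2
  obtain ⟨x₀, -, -⟩ := hne 0
  have : Nonempty V := ⟨x₀⟩
  have hcard : (Fintype.card V : ℝ) ≠ 0 := Nat.cast_ne_zero.2 Fintype.card_ne_zero
  have hzero : entrywise g (e 0) = Matrix.of fun _ _ => 1 / (Fintype.card V : ℝ) := by
    obtain ⟨c, hc⟩ : ∃ c, e 0 = C c :=
      ⟨_, Polynomial.eq_C_of_degree_eq_zero (by simpa using hdeg 0)⟩
    have hid := congrFun (congrFun (hE.idem 0) x₀) x₀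
    have hc0 : c ≠ 0 := fun h => hE0 0 (by rw [hc, h, map_zero, map_zero])
    simp only [Matrix.mul_apply, entrywise_apply, hc, Polynomial.eval_C, Finset.sum_const,
      Finset.card_univ, nsmul_eq_mul] at hid
    have hid' : (Fintype.card V : ℝ) * c = 1 := mul_right_cancel₀ hc0 (by linarith)
    ext x y
    simp only [entrywise_apply, hc, Polynomial.eval_C, Matrix.of_apply]
    field_simp
    linarith
  refine ⟨isAssociationScheme_of_mul_mem hsymm ha hval hne hdiag ?_,
    fun i => entrywise g (e i), ⟨hzero, ?_, hli, hspan⟩, fun i => ?_⟩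
  · rw [← hspan]
    intro A hA B hB
    obtain ⟨α, rfl⟩ := (Submodule.mem_span_range_iff_exists_fun ℝ).1 hA
    obtain ⟨β, rfl⟩ := (Submodule.mem_span_range_iff_exists_fun ℝ).1 hB
    rw [Finset.sum_mul_sum]
    refine Submodule.sum_mem _ fun i _ => Submodule.sum_mem _ fun j _ => ?_
    rw [Matrix.smul_mul, Matrix.mul_smul]
    refine Submodule.smul_mem _ _ (Submodule.smul_mem _ _ ?_)
    by_cases hij : i = j
    · subst hij
      rw [(hE.idem i).eq]
      exact Submodule.subset_span ⟨i, rfl⟩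
    · rw [hE.ortho hij]
      exact Submodule.zero_mem _
  · convert hE
  · by_cases hi0 : i = 0
    · subst hi0
      refine ⟨1, by simp, fun x y => ?_⟩
      change _ * entrywise g (e 0) x y = _
      rw [hzero]
      simp [hcard]
    · have hs : 1 ≤ s := by
        have := i.2
        have : (i : ℕ) ≠ 0 := fun h => hi0 (Fin.ext h)
        omega
      have h1 : (e 1).degree = 1 := by
        rw [hdeg 1, Fin.val_one', Nat.mod_eq_of_lt (by omega)]
        rfl
      obtain ⟨u, hu, c, hc⟩ : ∃ u : ℝ, u ≠ 0 ∧ ∃ c, e 1 = C u * X + C c :=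
        ⟨_, Polynomial.leadingCoeff_ne_zero.2 fun h => by simp [h] at h1, _,
          Polynomial.eq_X_add_C_of_degree_eq_one h1⟩
      have hpos : 0 < (i : ℕ) := Nat.pos_of_ne_zero fun h => hi0 (Fin.ext h)
      set n : ℝ := (Fintype.card V : ℝ) with hn
      -- The inner affine polynomial inverts g ↦ n(ug + c), recovering the kernel from |V| E_1.
      refine ⟨C n * (e i).comp (C (1 / (n * u)) * X + C (-(c / u))), ?_, fun x y => ?_⟩
      · rw [Polynomial.degree_C_mul hcard, Polynomial.degree_eq_iff_natDegree_eq_of_pos hpos,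
          Polynomial.natDegree_comp, Polynomial.natDegree_linear (by positivity), mul_one]
        exact Polynomial.natDegree_eq_of_degree_eq_some (hdeg i)
      · have harg : 1 / (n * u) * (n * (u * g x y + c)) + -(c / u) = g x y := by
          field_simp
          ring
        simp only [entrywise_apply, hc, Polynomial.eval_mul, Polynomial.eval_comp,
          Polynomial.eval_add, Polynomial.eval_C, Polynomial.eval_X, harg]

end AbstractScheme

/-! ### Dimension bound from the degree. -/

section Degree

variable {d : ℕ}

lemma one_le_of_unitSphere (x : UnitSphere d) : 1 ≤ d := by
  rcases d with _ | d
  · simpa using sum_sq_eq_one x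
  · omega

/-- On S^0 = {1, -1} the only inner product of distinct points is -1. -/
lemma two_le_of_two_le_sphDegree {X : Finset (UnitSphere d)} (h : 2 ≤ sphDegree X) : 2 ≤ d := by
  by_contra hd
  have hsub : degreeSet X ⊆ {-1} := by
    rintro _ ⟨x, -, y, -, hxy, rfl⟩
    obtain rfl : d = 1 := by
      have := one_le_of_unitSphere x
      omega
    have hx := sum_sq_eq_one x
    have hy := sum_sq_eq_one y
    have hne := mt (ip_eq_one_iff x y).1 hxy
    rw [ip_eq_sum] at hne ⊢
    simp only [Fin.sum_univ_one] at hx hy hne ⊢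
    have hsq : (x.1 0 * y.1 0) ^ 2 = 1 := by rw [mul_pow, hx, hy, one_mul]
    exact (mul_self_eq_one_iff.1 ((pow_two _).symm.trans hsq)).resolve_left hne
  have := Set.ncard_le_ncard hsub (Set.finite_singleton _)
  rw [Set.ncard_singleton] at this
  exact absurd (h.trans this) (by norm_num)

end Degree

/-! ### The case of one class. -/

section SmallClassNumber

variable {V : Type*} [Fintype V] {g : V → V → ℝ}

/-- A kernel with two values has the annihilating polynomial with matrix `I - J / |V|`. -/
lemma exists_annihilator_of_two_values {a : Fin 2 → ℝ} (ha : Function.Injective a)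
    (hval : ∀ x y, ∃ i, g x y = a i) (hne : ∀ i, ∃ x y, g x y = a i)
    (hdiag : ∀ x y, g x y = a 0 ↔ x = y) :
    ∃ T : ℝ[X], entrywise g T ≠ 0 ∧ ∀ q f : ℝ[X], q.natDegree + f.natDegree < 1 →
      entrywise g (q * T) * entrywise g f = 0 := by
  classical
  obtain ⟨x₀, y₀, h₀⟩ := hne 1
  have : Nonempty V := ⟨x₀⟩
  have hcard : (Fintype.card V : ℝ) ≠ 0 := Nat.cast_ne_zero.2 Fintype.card_ne_zero
  have h01 : a 0 - a 1 ≠ 0 := sub_ne_zero.2 fun h => by simpa using ha h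
  set T : ℝ[X] := C (1 / (a 0 - a 1)) * (X - C (a 1)) - C (1 / (Fintype.card V : ℝ)) with hTdef
  have hT (x y : V) : T.eval (g x y) = (if x = y then 1 else 0) - 1 / (Fintype.card V : ℝ) := by
    simp only [hTdef, Polynomial.eval_sub, Polynomial.eval_mul, Polynomial.eval_C,
      Polynomial.eval_X]
    by_cases hxy : x = y
    · rw [if_pos hxy, (hdiag x y).2 hxy, one_div_mul_cancel h01]
    · obtain ⟨i, hi⟩ := hval x y
      have hi0 : i ≠ 0 := fun h => hxy ((hdiag x y).1 (h ▸ hi))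
      rw [if_neg hxy, hi, Fin.eq_one_of_ne_zero i hi0, sub_self, mul_zero]
  refine ⟨T, fun h => ?_, fun q f hqf => ?_⟩
  · have hxy : x₀ ≠ y₀ := fun h => by
      simpa using ha (h₀.symm.trans ((hdiag x₀ y₀).2 h))
    have := congrFun (congrFun h x₀) y₀
    rw [entrywise_apply, hT, if_neg hxy] at this
    simp [hcard] at this
  · obtain ⟨c, hc⟩ := Polynomial.natDegree_eq_zero.1 (show q.natDegree = 0 by omega)
    obtain ⟨c', hc'⟩ := Polynomial.natDegree_eq_zero.1 (show f.natDegree = 0 by omega)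
    ext x y
    simp only [Matrix.mul_apply, entrywise_apply, ← hc, ← hc', Polynomial.eval_mul,
      Polynomial.eval_C, hT, ← Finset.sum_mul, ← Finset.mul_sum, Finset.sum_sub_distrib]
    simp [hcard]

end SmallClassNumber

end SphericalScheme

/-! ### The main theorem: the kernel is the Gram matrix of X. -/

theorem mainTheorem8 {d : ℕ} (X : Finset (SphericalScheme.UnitSphere d)) (hX : X.Nonempty)
    (w t s : ℕ) (hwt : SphericalScheme.HasDualZeroInterval X w t)
    (hs : SphericalScheme.sphDegree X = s) (hst : 2 * (s : ℤ) - 1 ≤ (t : ℤ))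
    (α : Fin s ≃ SphericalScheme.degreeSet X) :
    SphericalScheme.IsQPolynomialScheme (SphericalScheme.sphereRel X α) := by
  open SphericalScheme in
  obtain ⟨x₀, hx₀⟩ := hX
  set a : Fin (s + 1) → ℝ := Fin.cons 1 (fun j => (α j : ℝ)) with ha_def
  set g : X → X → ℝ := fun x y => ip x.1 y.1 with hg
  have hsymm : ∀ x y, g x y = g y x := fun x y => ip_comm _ _
  have hdiag : ∀ x y, g x y = a 0 ↔ x = y := fun x y => by
    rw [Subtype.ext_iff, ← ip_eq_one_iff]
    rfl
  have ha : Function.Injective a := by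
    refine Fin.cons_injective_iff.2 ⟨?_, Subtype.val_injective.comp α.injective⟩
    rintro ⟨j, hj⟩
    obtain ⟨x, -, y, -, hxy, h⟩ := (α j).2
    exact hxy ((ip_eq_one_iff x y).1 (h.trans hj))
  have hval : ∀ x y, ∃ i, g x y = a i := fun x y => by
    by_cases hxy : x = y
    · exact ⟨0, (hdiag x y).2 hxy⟩
    · refine ⟨(α.symm ⟨ip x.1 y.1, x, x.2, y, y.2, fun h => hxy (Subtype.ext h), rfl⟩).succ, ?_⟩
      simp [ha_def, hg]
  have hne : ∀ i, ∃ x y, g x y = a i := by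
    refine Fin.cases ⟨⟨x₀, hx₀⟩, ⟨x₀, hx₀⟩, (hdiag _ _).2 rfl⟩ fun j => ?_
    obtain ⟨x, hx, y, hy, -, h⟩ := (α j).2
    exact ⟨⟨x, hx⟩, ⟨y, hy⟩, by simpa [ha_def, hg] using h⟩
  obtain ⟨T, hT, hmul⟩ : ∃ T : ℝ[X], entrywise g T ≠ 0 ∧ ∀ q f : ℝ[X],
      q.natDegree + f.natDegree < s → entrywise g (q * T) * entrywise g f = 0 := by
    -- Using T = Q_{w+s} relies on Q_{w+s}(1) > 0, hence on d ≥ 2, which s ≥ 2 ensures. For smaller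
    -- s a direct choice of T avoids any condition on d.
    obtain rfl | rfl | hs2 : s = 0 ∨ s = 1 ∨ 2 ≤ s := by omega
    · refine ⟨1, fun h => ?_, fun q f h => absurd h (Nat.not_lt_zero _)⟩
      simpa using congrFun (congrFun h ⟨x₀, hx₀⟩) ⟨x₀, hx₀⟩
    · exact exists_annihilator_of_two_values ha hval hne hdiag
    · have hd : 2 ≤ d := two_le_of_two_le_sphDegree (hs ▸ hs2)
      refine ⟨gegenbauer d (w + s), fun h => ?_, fun q f hqf => ?_⟩
      · have h1 := congrFun (congrFun h ⟨x₀, hx₀⟩) ⟨x₀, hx₀⟩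
        rw [entrywise_apply, hg] at h1
        simp only [ip_self] at h1
        exact (eval_one_gegenbauer_pos hd x₀ _).ne' h1
      · ext x y
        rw [Matrix.mul_apply]
        have h1 := sum_gegenbauer_mul_eq_zero (by omega) ⟨x₀, hx₀⟩ hwt.2.2 hst hqf x.1 y.1
        rw [← Finset.sum_coe_sort] at h1
        exact h1
  exact isQPolynomialScheme_of_annihilator hsymm ha hval hne hdiag hT hmul
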